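/- **Corollary 4.6.** All rings are associative with identity and are left and right noetherian; modules are left modules unless stated otherwise. *Definitions.* Rings $\Lambda$ and $\Gamma$ are *symmetrically separably equivalent* if there are bimodules ${}_\Lambda M_\Gamma$ and ${}_\Gamma N_\Lambda$, each finitely generated and projective as a left module and as a right module, and bimodules ${}_\Lambda X_\Lambda$ and ${}_\Gamma Y_\Gamma$, with bimodule isomorphisms $$M\otimes_\Gamma N\cong \Lambda\oplus X,\qquad N\otimes_\Lambda M\cong \Gamma\oplus Y,$$ such that $(M\otimes_\Gamma -,\,N\otimes_\Lambda -)$ and $(N\otimes_\Lambda -,\,M\otimes_\Gamma -)$ are adjoint pairs of functors between the categories of all left $\Gamma$-modules and all left $\Lambda$-modules. For a ring $R$, let $0\to R\to I^0(R)\to I^1(R)\to\cdots$ be the minimal injective resolution of $R$ as a left $R$-module, and let $\mathrm{fd}$ denote the flat dimension of left $R$-modules. For an integer $n\ge 0$, the ring $R$ is *$n$-Gorenstein* if $\mathrm{fd}\, I^i(R)\le i$ for all $0\le i\le n-1$, and *(left) quasi $n$-Gorenstein* if $\mathrm{fd}\, I^i(R)\le i+1$ for all $0\le i\le n-1$. The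 ring $R$ *satisfies the Auslander condition* if it is $n$-Gorenstein for every $n$. *Statement.* Let $\Lambda$ and $\Gamma$ be symmetrically separably equivalent left and right noetherian rings, and let $n$ be a nonnegative integer. Then 1. $\Lambda$ is $n$-Gorenstein if and only if $\Gamma$ is $n$-Gorenstein; 2. $\Lambda$ is quasi $n$-Gorenstein if and only if $\Gamma$ is quasi $n$-Gorenstein; 3. $\Lambda$ satisfies the Auslander condition if and only if $\Gamma$ satisfies the Auslander condition. -/

import Mathlib

open CategoryTheory MulOpposite

open scoped TensorProduct

/-! Right modules over a ring `R` are left modules over `Rᵐᵒᵖ`; an `S`-`R`-bimodule is an abelian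
group with commuting actions of `S` and `Rᵐᵒᵖ`. -/

universe u

section BalancedTensor

universe v w

/-- The relations `m r ⊗ n = m ⊗ r n` in the tensor product over the integers of a right
`R`-module `M` and a left `R`-module `N`. -/
def balancedRelations (R : Type u) (M : Type v) (N : Type w) [Ring R] [AddCommGroup M]
    [AddCommGroup N] [Module Rᵐᵒᵖ M] [Module R N] : AddSubgroup (M ⊗[ℤ] N) :=
  AddSubgroup.closure
    {x | ∃ (m : M) (r : R) (n : N), x = (op r • m) ⊗ₜ[ℤ] n - m ⊗ₜ[ℤ] (r • n)}

/-- The tensor product `M ⊗_R N` of a right `R`-module and a left `R`-module over a ring `R` that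
need not be commutative. -/
def BalancedTensor (R : Type u) (M : Type v) (N : Type w) [Ring R] [AddCommGroup M]
    [AddCommGroup N] [Module Rᵐᵒᵖ M] [Module R N] : Type (max v w) :=
  (M ⊗[ℤ] N) ⧸ balancedRelations R M N

namespace BalancedTensor

variable (R : Type u) {M : Type v} {N : Type w} [Ring R] [AddCommGroup M] [AddCommGroup N]
  [Module Rᵐᵒᵖ M] [Module R N]

instance : AddCommGroup (BalancedTensor R M N) :=
  inferInstanceAs (AddCommGroup ((M ⊗[ℤ] N) ⧸ balancedRelations R M N))

/-- The pure tensor `m ⊗ n`. -/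
def tmul (m : M) (n : N) : BalancedTensor R M N :=
  QuotientAddGroup.mk' (balancedRelations R M N) (m ⊗ₜ[ℤ] n)

theorem add_tmul (m m' : M) (n : N) : tmul R (m + m') n = tmul R m n + tmul R m' n := by
  simp only [tmul, TensorProduct.add_tmul, map_add]; rfl

theorem tmul_add (m : M) (n n' : N) : tmul R m (n + n') = tmul R m n + tmul R m n' := by
  simp only [tmul, TensorProduct.tmul_add, map_add]; rfl

theorem op_smul_tmul (r : R) (m : M) (n : N) : tmul R (op r • m) n = tmul R m (r • n) := by
  refine (QuotientAddGroup.eq_iff_sub_mem).2 ?_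
  exact AddSubgroup.subset_closure ⟨m, r, n, rfl⟩

theorem induction_on {p : BalancedTensor R M N → Prop} (x : BalancedTensor R M N)
    (zero : p 0) (tmul : ∀ m n, p (tmul R m n)) (add : ∀ x y, p x → p y → p (x + y)) : p x := by
  obtain ⟨y, rfl⟩ := QuotientAddGroup.mk'_surjective (balancedRelations R M N) x
  induction y using TensorProduct.induction_on with
  | zero => rw [map_zero]; exact zero
  | tmul m n => exact tmul m n
  | add a b ha hb => rw [map_add]; exact add _ _ ha hb

theorem addHom_ext {P : Type*} [AddCommGroup P] {f g : BalancedTensor R M N →+ P}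
    (h : ∀ m n, f (tmul R m n) = g (tmul R m n)) : f = g := by
  ext x
  induction x using BalancedTensor.induction_on with
  | zero => simp
  | tmul m n => exact h m n
  | add a b ha hb => simp [ha, hb]

/-- The additive map out of `M ⊗_R N` induced by a balanced biadditive map. -/
def lift {P : Type*} [AddCommGroup P] (f : M →+ N →+ P)
    (hf : ∀ (m : M) (r : R) (n : N), f (op r • m) n = f m (r • n)) :
    BalancedTensor R M N →+ P :=
  QuotientAddGroup.lift (balancedRelations R M N)
    (TensorProduct.liftAddHom f fun r m n => by simp)
    (by
      rw [balancedRelations, AddSubgroup.closure_le]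
      rintro _ ⟨m, r, n, rfl⟩
      simp [hf])

@[simp]
theorem lift_tmul {P : Type*} [AddCommGroup P] (f : M →+ N →+ P)
    (hf : ∀ (m : M) (r : R) (n : N), f (op r • m) n = f m (r • n)) (m : M) (n : N) :
    lift R f hf (tmul R m n) = f m n := rfl

/-- The additive map `f ⊗ g`. -/
def map {M' N' : Type*} [AddCommGroup M'] [AddCommGroup N'] [Module Rᵐᵒᵖ M'] [Module R N']
    (f : M →ₗ[Rᵐᵒᵖ] M') (g : N →ₗ[R] N') : BalancedTensor R M N →+ BalancedTensor R M' N' :=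
  lift R
    (AddMonoidHom.mk'
      (fun m => AddMonoidHom.mk' (fun n => tmul R (f m) (g n)) fun a b => by
        simp [tmul_add])
      fun a b => by ext n; simp [add_tmul])
    (fun m r n => by simp [op_smul_tmul])

@[simp]
theorem map_tmul {M' N' : Type*} [AddCommGroup M'] [AddCommGroup N'] [Module Rᵐᵒᵖ M']
    [Module R N'] (f : M →ₗ[Rᵐᵒᵖ] M') (g : N →ₗ[R] N') (m : M) (n : N) :
    map R f g (tmul R m n) = tmul R (f m) (g n) := rfl

section LeftAction

variable {S : Type*} [Ring S] [Module S M] [SMulCommClass S Rᵐᵒᵖ M]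

/-- If `M` is an `S`-`R`-bimodule, then `M ⊗_R N` is a left `S`-module by
`s (m ⊗ n) = (s m) ⊗ n`. -/
instance leftModule : Module S (BalancedTensor R M N) where
  smul s x := map R (Module.toModuleEnd Rᵐᵒᵖ (S := S) M s) LinearMap.id x
  one_smul x := by
    change map R _ _ x = x
    induction x using BalancedTensor.induction_on with
    | zero => simp
    | tmul m n => simp
    | add a b ha hb => rw [map_add, ha, hb]
  mul_smul s t x := by
    change map R _ _ x = map R _ _ (map R _ _ x)
    induction x using BalancedTensor.induction_on with
    | zero => simp
    | tmul m n => simp [mul_smul]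
    | add a b ha hb => simp only [map_add] at *; rw [ha, hb]
  smul_zero s := map_zero _
  smul_add s x y := map_add _ x y
  add_smul s t x := by
    change map R _ _ x = map R _ _ x + map R _ _ x
    induction x using BalancedTensor.induction_on with
    | zero => simp
    | tmul m n => simp [add_smul, add_tmul]
    | add a b ha hb => simp only [map_add] at *; rw [ha, hb]; abel
  zero_smul x := by
    change map R _ _ x = 0
    induction x using BalancedTensor.induction_on with
    | zero => simp
    | tmul m n =>
      have h := add_tmul R (0 : M) 0 n
      simp only [add_zero, left_eq_add] at h
      simpa using h
    | add a b ha hb => rw [map_add, ha, hb, add_zero]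

theorem smul_tmul (s : S) (m : M) (n : N) : s • tmul R m n = tmul R (s • m) n := rfl

end LeftAction

section RightAction

variable {T : Type*} [Ring T] [Module Tᵐᵒᵖ N] [SMulCommClass R Tᵐᵒᵖ N]

/-- The right action of `t` on an `R`-`T`-bimodule, as a left `R`-linear map. -/
def rightMul (t : Tᵐᵒᵖ) : N →ₗ[R] N where
  toFun n := t • n
  map_add' := smul_add t
  map_smul' r n := (smul_comm r t n).symm

@[simp]
theorem rightMul_apply (t : Tᵐᵒᵖ) (n : N) : rightMul R t n = t • n := rfl

/-- If `N` is an `R`-`T`-bimodule, then `M ⊗_R N` is a right `T`-module by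
`(m ⊗ n) t = m ⊗ (n t)`. -/
instance rightModule : Module Tᵐᵒᵖ (BalancedTensor R M N) where
  smul t x := map R LinearMap.id (rightMul R t) x
  one_smul x := by
    change map R _ _ x = x
    induction x using BalancedTensor.induction_on with
    | zero => simp
    | tmul m n => simp
    | add a b ha hb => rw [map_add, ha, hb]
  mul_smul s t x := by
    change map R _ _ x = map R _ _ (map R _ _ x)
    induction x using BalancedTensor.induction_on with
    | zero => simp
    | tmul m n => simp [mul_smul]
    | add a b ha hb => simp only [map_add] at *; rw [ha, hb]
  smul_zero s := map_zero _
  smul_add s x y := map_add _ x y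
  add_smul s t x := by
    change map R _ _ x = map R _ _ x + map R _ _ x
    induction x using BalancedTensor.induction_on with
    | zero => simp
    | tmul m n => simp [add_smul, tmul_add]
    | add a b ha hb => simp only [map_add] at *; rw [ha, hb]; abel
  zero_smul x := by
    change map R _ _ x = 0
    induction x using BalancedTensor.induction_on with
    | zero => simp
    | tmul m n =>
      have h := tmul_add R m (0 : N) 0
      simp only [add_zero, left_eq_add] at h
      simpa using h
    | add a b ha hb => rw [map_add, ha, hb, add_zero]

theorem op_smul_tmul' (t : T) (m : M) (n : N) : op t • tmul R m n = tmul R m (op t • n) := rfl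

end RightAction

/-- The functor `M ⊗_R -` from left `R`-modules to left `S`-modules given by an
`S`-`R`-bimodule `M`. -/
def functor (R S M : Type u) [Ring R] [Ring S] [AddCommGroup M] [Module S M] [Module Rᵐᵒᵖ M]
    [SMulCommClass S Rᵐᵒᵖ M] : ModuleCat.{u} R ⥤ ModuleCat.{u} S where
  obj V := ModuleCat.of S (BalancedTensor R M V)
  map {V W} f := ModuleCat.ofHom
    { map R (LinearMap.id : M →ₗ[Rᵐᵒᵖ] M) f.hom with
      map_smul' := fun s x => by
        change map R _ _ (s • x) = s • map R _ _ x
        induction x using BalancedTensor.induction_on with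
        | zero => simp
        | tmul m n => simp [smul_tmul]
        | add a b ha hb => simp only [smul_add, map_add, ha, hb] }
  map_id V := by
    ext x
    change map R _ _ x = x
    induction x using BalancedTensor.induction_on with
    | zero => simp
    | tmul m n => simp
    | add a b ha hb => rw [map_add, ha, hb]
  map_comp f g := by
    ext x
    change map R _ _ x = map R _ _ (map R _ _ x)
    induction x using BalancedTensor.induction_on with
    | zero => simp
    | tmul m n => simp
    | add a b ha hb => simp only [map_add] at *; rw [ha, hb]

end BalancedTensor

end BalancedTensor

section SeparableEquivalence

/-- The `Λ`-bimodule `B` is isomorphic to `Λ ⊕ X` for some `Λ`-bimodule `X`. -/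
def HasRegularSummand (Λ B : Type u) [Ring Λ] [AddCommGroup B] [Module Λ B] [Module Λᵐᵒᵖ B] :
    Prop :=
  ∃ (X : Type u) (_ : AddCommGroup X) (_ : Module Λ X) (_ : Module Λᵐᵒᵖ X)
    (_ : SMulCommClass Λ Λᵐᵒᵖ X) (e : B ≃ₗ[Λ] Λ × X),
    ∀ (a : Λ) (b : B), e (op a • b) = op a • e b

/-- The bimodules `M` (over `Λ`-`Γ`) and `N` (over `Γ`-`Λ`) induce a separable equivalence between
`Λ` and `Γ`. -/
structure InduceSeparableEquivalence (Λ Γ M N : Type u) [Ring Λ] [Ring Γ]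
    [AddCommGroup M] [Module Λ M] [Module Γᵐᵒᵖ M] [SMulCommClass Λ Γᵐᵒᵖ M]
    [AddCommGroup N] [Module Γ N] [Module Λᵐᵒᵖ N] [SMulCommClass Γ Λᵐᵒᵖ N] : Prop where
  finite_left_M : Module.Finite Λ M
  projective_left_M : Module.Projective Λ M
  finite_right_M : Module.Finite Γᵐᵒᵖ M
  projective_right_M : Module.Projective Γᵐᵒᵖ M
  finite_left_N : Module.Finite Γ N
  projective_left_N : Module.Projective Γ N
  finite_right_N : Module.Finite Λᵐᵒᵖ N
  projective_right_N : Module.Projective Λᵐᵒᵖ N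
  summand_left : HasRegularSummand Λ (BalancedTensor Γ M N)
  summand_right : HasRegularSummand Γ (BalancedTensor Λ N M)

/-- The rings `Λ` and `Γ` are symmetrically separably equivalent. -/
def SymmetricallySeparablyEquivalent (Λ Γ : Type u) [Ring Λ] [Ring Γ] : Prop :=
  ∃ (M N : Type u)
    (_ : AddCommGroup M) (_ : Module Λ M) (_ : Module Γᵐᵒᵖ M) (_ : SMulCommClass Λ Γᵐᵒᵖ M)
    (_ : AddCommGroup N) (_ : Module Γ N) (_ : Module Λᵐᵒᵖ N) (_ : SMulCommClass Γ Λᵐᵒᵖ N),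
    InduceSeparableEquivalence Λ Γ M N ∧
      Nonempty (BalancedTensor.functor Γ Λ M ⊣ BalancedTensor.functor Λ Γ N) ∧
      Nonempty (BalancedTensor.functor Λ Γ N ⊣ BalancedTensor.functor Γ Λ M)

end SeparableEquivalence

section Gorenstein

variable (R : Type u) [Ring R]

/-- The left `R`-module `V` is flat: `- ⊗_R V` preserves injectivity of maps of right
`R`-modules. -/
def IsFlatModule (V : Type u) [AddCommGroup V] [Module R V] : Prop :=
  ∀ (A B : Type u) [AddCommGroup A] [AddCommGroup B] [Module Rᵐᵒᵖ A] [Module Rᵐᵒᵖ B]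
    (f : A →ₗ[Rᵐᵒᵖ] B), Function.Injective f →
      Function.Injective (BalancedTensor.map R f (LinearMap.id : V →ₗ[R] V))

/-- The flat dimension of the left `R`-module `V` is at most `m`: there is an exact sequence
`0 → F m → ⋯ → F 1 → F 0 → V → 0` with all `F i` flat. -/
def FlatDimensionLE (m : ℕ) (V : Type u) [AddCommGroup V] [Module R V] : Prop :=
  ∃ (F : ℕ → ModuleCat.{u} R) (d : ∀ i, F (i + 1) →ₗ[R] F i) (ε : F 0 →ₗ[R] V),
    (∀ i, IsFlatModule R (F i)) ∧
    Function.Surjective ε ∧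
    Function.Exact (d 0) ε ∧
    (∀ i, Function.Exact (d (i + 1)) (d i)) ∧
    ∀ i, m < i → Subsingleton (F i)

variable {R} in
/-- The submodule `K` of `V` is essential: it meets every nonzero submodule. -/
def Submodule.IsEssentialIn {V : Type u} [AddCommGroup V] [Module R V] (K : Submodule R V) :
    Prop :=
  ∀ S : Submodule R V, S ⊓ K = ⊥ → S = ⊥

variable {R} in
/-- An injective resolution `0 → V → I 0 → I 1 → ⋯` is minimal if `I i` is an injective envelope of
the kernel of `I i → I (i + 1)` for every `i`. By exactness, this kernel is (the image of) `V` for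
`i = 0` and the image of `I (i - 1) → I i` for `i > 0`. -/
def IsMinimalInjectiveResolution {V : ModuleCat.{u} R} (I : InjectiveResolution V) : Prop :=
  ∀ i : ℕ, (LinearMap.ker (I.cocomplex.d i (i + 1)).hom).IsEssentialIn

/-- The condition `G_n(k)`: in the minimal injective resolution of `R` as a left module over itself
(which exists and is unique up to isomorphism), the `i`-th term has flat dimension at most `i + k`
for all `i < n`. -/
def IsGorensteinType (n k : ℕ) : Prop :=
  ∃ I : InjectiveResolution (ModuleCat.of R R), IsMinimalInjectiveResolution I ∧
    ∀ i < n, FlatDimensionLE R (i + k) (I.cocomplex.X i)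

/-- `R` is `n`-Gorenstein: `fd I^i(R) ≤ i` for all `0 ≤ i ≤ n - 1`. -/
def IsNGorenstein (n : ℕ) : Prop :=
  IsGorensteinType R n 0

/-- `R` is (left) quasi `n`-Gorenstein: `fd I^i(R) ≤ i + 1` for all `0 ≤ i ≤ n - 1`. -/
def IsQuasiNGorenstein (n : ℕ) : Prop :=
  IsGorensteinType R n 1

/-- `R` satisfies the Auslander condition: it is `n`-Gorenstein for all `n`. -/
def AuslanderCondition : Prop :=
  ∀ n : ℕ, IsNGorenstein R n

end Gorenstein

/-! Write `Λ` and `Γ` for the two rings and `M`, `N` for the bimodules. The two adjunctions make `N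
⊗ -` exact, and it preserves injectives because its left adjoint `M ⊗ -` preserves monomorphisms. As
`N` is flat over `Γ`, it also preserves flat modules, so it does not raise flat dimension. Since `M`
is a direct summand of some `Λ^m`, applying `N ⊗ -` to the `m`-th power of the minimal injective
resolution of `Λ` gives an injective coresolution of `N ⊗ Λ^m` with the same bounds on flat
dimension; and `Γ` is a summand of `N ⊗ M`, hence of `N ⊗ Λ^m`.

It remains to pass to the minimal resolution of `Γ`. By essentiality its terms are direct summands,
degree by degree, of the terms of any injective coresolution of a module having `Γ` as a summand
(`exists_retract_of_essential`). Flat dimension descends to summands because it equals the injective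
dimension of the character module (`flatDimensionLE_iff`). The hypotheses are symmetric in the two
rings, so one implication suffices. -/

/-! ### Character modules. -/

section CharacterDual

/-- The group of characters of a left `R`-module, regarded as a right `R`-module. -/
def CharacterDual (V : Type u) [AddCommGroup V] : Type u := V →+ AddCircle (1 : ℚ)

namespace CharacterDual

variable {R : Type u} [Ring R] {V W U : Type u} [AddCommGroup V] [AddCommGroup W] [AddCommGroup U]
  [Module R V] [Module R W] [Module R U]

instance : AddCommGroup (CharacterDual V) :=
  inferInstanceAs (AddCommGroup (V →+ AddCircle (1 : ℚ)))

instance : FunLike (CharacterDual V) V (AddCircle (1 : ℚ)) :=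
  inferInstanceAs (FunLike (V →+ AddCircle (1 : ℚ)) V (AddCircle (1 : ℚ)))

instance : AddMonoidHomClass (CharacterDual V) V (AddCircle (1 : ℚ)) :=
  inferInstanceAs (AddMonoidHomClass (V →+ AddCircle (1 : ℚ)) V (AddCircle (1 : ℚ)))

@[ext]
theorem ext {c c' : CharacterDual V} (h : ∀ v, c v = c' v) : c = c' := DFunLike.ext _ _ h

@[simp]
theorem add_apply (c c' : CharacterDual V) (v : V) : (c + c') v = c v + c' v := rfl

instance : Module Rᵐᵒᵖ (CharacterDual V) where
  smul r c := AddMonoidHom.comp c (DistribSMul.toAddMonoidHom V r.unop)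
  one_smul c := ext fun v => congrArg c (one_smul R v)
  mul_smul r s c := ext fun v => congrArg c (mul_smul s.unop r.unop v)
  smul_zero _ := rfl
  smul_add _ _ _ := rfl
  add_smul r s c := ext fun v => (congrArg c (add_smul r.unop s.unop v)).trans (map_add c _ _)
  zero_smul c := ext fun v => (congrArg c (zero_smul R v)).trans (map_zero c)

theorem smul_apply (r : Rᵐᵒᵖ) (c : CharacterDual V) (v : V) : (r • c) v = c (r.unop • v) := rfl

/-- The right `R`-linear map on characters induced by a left `R`-linear map. -/
def map (f : V →ₗ[R] W) : CharacterDual W →ₗ[Rᵐᵒᵖ] CharacterDual V where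
  toFun c := AddMonoidHom.comp c f.toAddMonoidHom
  map_add' _ _ := rfl
  map_smul' r c := ext fun v => congrArg c (f.map_smul r.unop v).symm

theorem map_injective {f : V →ₗ[R] W} (hf : Function.Surjective f) :
    Function.Injective (map f) := fun c c' h => ext fun w => by
  obtain ⟨v, rfl⟩ := hf w
  exact DFunLike.congr_fun h v

/-- The group `ℚ/ℤ` is divisible, so characters extend along injections. -/
theorem map_surjective {f : V →ₗ[R] W} (hf : Function.Injective f) :
    Function.Surjective (map f) := fun c => by
  obtain ⟨h, hh⟩ := (Module.Baer.of_divisible (AddCircle (1 : ℚ))).extension_property_addMonoidHom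
    f.toAddMonoidHom hf c
  exact ⟨h, ext fun v => DFunLike.congr_fun hh v⟩

theorem map_exact {f : V →ₗ[R] W} {g : W →ₗ[R] U} (hfg : Function.Exact f g)
    (hg : Function.Surjective g) : Function.Exact (map g) (map f) := fun c => by
  constructor
  · intro h
    -- A character that vanishes on the range of `f` vanishes on the kernel of `g`, hence descends
    -- along the surjection `g`.
    refine ⟨AddMonoidHom.liftOfRightInverse g.toAddMonoidHom (Function.surjInv hg)
      (Function.rightInverse_surjInv hg) ⟨c, fun w hw => ?_⟩, ext fun w => ?_⟩
    · obtain ⟨v, rfl⟩ := (hfg w).1 hw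
      exact DFunLike.congr_fun h v
    · exact AddMonoidHom.liftOfRightInverse_comp_apply g.toAddMonoidHom (Function.surjInv hg)
        (Function.rightInverse_surjInv hg) _ w
  · rintro ⟨d, rfl⟩
    ext v
    exact (congrArg d (hfg.apply_apply_eq_zero v)).trans (map_zero d)

/-- The dual of a short exact sequence is short exact. -/
theorem shortExact {f : V →ₗ[R] W} {g : W →ₗ[R] U} (hf : Function.Injective f)
    (hfg : Function.Exact f g) (hg : Function.Surjective g) :
    (ShortComplex.mk (ModuleCat.ofHom (map g)) (ModuleCat.ofHom (map f))
      (by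
        ext c v
        exact (map_exact hfg hg).apply_apply_eq_zero c ▸ rfl)).ShortExact :=
  ModuleCat.shortComplex_shortExact _ (map_exact hfg hg) (map_injective hg) (map_surjective hf)

/-- The dual of a retract is a retract. -/
def retract {i : V →ₗ[R] W} {r : W →ₗ[R] V} (h : ∀ v, r (i v) = v) :
    Retract (ModuleCat.of Rᵐᵒᵖ (CharacterDual V)) (ModuleCat.of Rᵐᵒᵖ (CharacterDual W)) where
  i := ModuleCat.ofHom (map r)
  r := ModuleCat.ofHom (map i)
  retract := by
    ext c v
    exact congrArg c (h v)

/-- A right `R`-linear map `A → V⋆` as a character of `A ⊗ V`. -/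
def uncurry {A : Type u} [AddCommGroup A] [Module Rᵐᵒᵖ A] (g : A →ₗ[Rᵐᵒᵖ] CharacterDual V) :
    BalancedTensor R A V →+ AddCircle (1 : ℚ) :=
  BalancedTensor.lift R
    (AddMonoidHom.mk' (fun a => (show V →+ AddCircle (1 : ℚ) from g a)) fun a b => g.map_add a b)
    fun a r v => DFunLike.congr_fun (g.map_smul (op r) a) v

/-- A character of `A ⊗ V` as a right `R`-linear map `A → V⋆`. -/
def curry {A : Type u} [AddCommGroup A] [Module Rᵐᵒᵖ A]
    (c : BalancedTensor R A V →+ AddCircle (1 : ℚ)) : A →ₗ[Rᵐᵒᵖ] CharacterDual V where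
  toFun a := AddMonoidHom.mk' (fun v => c (BalancedTensor.tmul R a v)) fun v w => by
    rw [BalancedTensor.tmul_add, map_add]
  map_add' a b := ext fun v =>
    (congrArg c (BalancedTensor.add_tmul R a b v)).trans (map_add c _ _)
  map_smul' r a := ext fun v => congrArg c (BalancedTensor.op_smul_tmul R r.unop a v)

theorem finsupp_ext {ι : Type u} {c c' : CharacterDual (ι →₀ V)}
    (h : ∀ i v, c (Finsupp.single i v) = c' (Finsupp.single i v)) : c = c' :=
  Finsupp.addHom_ext (N := AddCircle (1 : ℚ)) h

/-- A family of characters of `V` assembled to a character of `ι →₀ V`. -/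
noncomputable def finsupp {ι : Type u} (c : ι → CharacterDual V) : CharacterDual (ι →₀ V) :=
  Finsupp.liftAddHom (N := AddCircle (1 : ℚ)) c

@[simp]
theorem finsupp_single {ι : Type u} (c : ι → CharacterDual V) (i : ι) (v : V) :
    finsupp c (Finsupp.single i v) = c i v :=
  Finsupp.liftAddHom_apply_single (N := AddCircle (1 : ℚ)) c i v

/-- A family of maps `B → V⋆` assembled to a map `B → (ι →₀ V)⋆`. -/
noncomputable def finsuppLift {ι B : Type u} [AddCommGroup B] [Module Rᵐᵒᵖ B]
    (l : ι → B →ₗ[Rᵐᵒᵖ] CharacterDual V) : B →ₗ[Rᵐᵒᵖ] CharacterDual (ι →₀ V) where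
  toFun b := finsupp fun i => l i b
  map_add' b c := finsupp_ext fun i v => by simp
  map_smul' r b := finsupp_ext fun i v => by simp [smul_apply]

theorem finsuppLift_single {ι B : Type u} [AddCommGroup B] [Module Rᵐᵒᵖ B]
    (l : ι → B →ₗ[Rᵐᵒᵖ] CharacterDual V) (b : B) (i : ι) (v : V) :
    finsuppLift l b (Finsupp.single i v) = l i b v :=
  finsupp_single _ i v

end CharacterDual

end CharacterDual

/-! ### Flat modules. -/

section Flat

variable {R : Type u} [Ring R] {V W : Type u} [AddCommGroup V] [AddCommGroup W]
  [Module R V] [Module R W]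

/-- Lambek's criterion. -/
theorem isFlatModule_iff_injective_characterDual :
    IsFlatModule R V ↔ Module.Injective Rᵐᵒᵖ (CharacterDual V) := by
  constructor
  · refine fun h => ⟨fun A B _ _ _ _ f hf g => ?_⟩
    -- Maps `A → V⋆` are characters of `A ⊗ V`; flatness makes `A ⊗ V → B ⊗ V` injective, and
    -- characters extend along it.
    obtain ⟨c, hc⟩ := (Module.Baer.of_divisible
      (AddCircle (1 : ℚ))).extension_property_addMonoidHom _ (h A B f hf) (CharacterDual.uncurry g)
    refine ⟨CharacterDual.curry c, fun a => CharacterDual.ext fun v => ?_⟩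
    exact DFunLike.congr_fun hc (BalancedTensor.tmul R a v)
  · intro h A B _ _ _ _ f hf
    refine (injective_iff_map_eq_zero _).2 fun x hx => ?_
    -- Characters separate points, and each character of `A ⊗ V` factors through `B ⊗ V`, where the
    -- image of `x` is zero.
    refine CharacterModule.eq_zero_of_character_apply fun c => ?_
    obtain ⟨g, hg⟩ := h.out f hf (CharacterDual.curry (R := R) (V := V) c)
    have key : (CharacterDual.uncurry g).comp (BalancedTensor.map R f (LinearMap.id : V →ₗ[R] V)) =
        (show BalancedTensor R A V →+ AddCircle (1 : ℚ) from c) := by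
      refine BalancedTensor.addHom_ext R fun a v => ?_
      exact DFunLike.congr_fun (hg a) v
    refine (DFunLike.congr_fun key x).symm.trans ?_
    rw [AddMonoidHom.comp_apply, hx, map_zero]

theorem IsFlatModule.of_retract (h : IsFlatModule R W) {i : V →ₗ[R] W} {r : W →ₗ[R] V}
    (hri : ∀ v, r (i v) = v) : IsFlatModule R V := by
  rw [isFlatModule_iff_injective_characterDual, Module.injective_iff_injective_object] at *
  exact (CharacterDual.retract hri).injective

theorem isFlatModule_self : IsFlatModule R R := by
  intro A B _ _ _ _ f hf
  -- `σ` is the natural map `C ⊗ R → C`, `c ⊗ r ↦ c r`. It is injective, since `c ↦ c ⊗ 1` is a left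
  -- inverse.
  let σ (C : Type u) [AddCommGroup C] [Module Rᵐᵒᵖ C] : BalancedTensor R C R →+ C :=
    BalancedTensor.lift R
      (AddMonoidHom.mk' (fun c => AddMonoidHom.mk' (fun r : R => op r • c) fun r s => by
        rw [MulOpposite.op_add, add_smul]) fun c d => by ext r; exact smul_add _ _ _)
      fun c r s => by simp [mul_smul]
  have hσ (x : BalancedTensor R A R) : BalancedTensor.tmul R (σ A x) 1 = x := by
    induction x using BalancedTensor.induction_on with
    | zero => exact (AddMonoidHom.mk' (fun a => BalancedTensor.tmul R a (1 : R))
        fun a b => BalancedTensor.add_tmul R a b 1).map_zero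
    | tmul a r =>
      change BalancedTensor.tmul R (op r • a) 1 = _
      rw [BalancedTensor.op_smul_tmul, smul_eq_mul, mul_one]
    | add x y hx hy => rw [map_add, BalancedTensor.add_tmul, hx, hy]
  have hnat : (σ B).comp (BalancedTensor.map R f (LinearMap.id : R →ₗ[R] R)) =
      f.toAddMonoidHom.comp (σ A) :=
    BalancedTensor.addHom_ext R fun a r => (f.map_smul (op r) a).symm
  refine (injective_iff_map_eq_zero _).2 fun x hx => ?_
  have h1 := DFunLike.congr_fun hnat x
  rw [AddMonoidHom.comp_apply, hx, map_zero] at h1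
  have h2 : σ A x = 0 := hf (h1.symm.trans f.map_zero.symm)
  rw [← hσ x, h2, ← hσ 0, map_zero]

/-- The dual of a direct sum is the product of the duals, so maps into it extend one coordinate at a
time. -/
theorem IsFlatModule.finsupp (h : IsFlatModule R V) (ι : Type u) : IsFlatModule R (ι →₀ V) := by
  rw [isFlatModule_iff_injective_characterDual] at *
  refine ⟨fun A B _ _ _ _ f hf g => ?_⟩
  choose l hl using fun i => h.out f hf
    ((CharacterDual.map (Finsupp.lsingle i : V →ₗ[R] ι →₀ V)).comp g)
  refine ⟨CharacterDual.finsuppLift l, fun a => CharacterDual.finsupp_ext fun i v => ?_⟩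
  rw [CharacterDual.finsuppLift_single]
  exact DFunLike.congr_fun (hl i a) v

theorem isFlatModule_of_projective [Module.Projective R V] : IsFlatModule R V := by
  obtain ⟨s, hs⟩ := Module.projective_def'.1 (inferInstance : Module.Projective R V)
  exact (isFlatModule_self.finsupp V).of_retract (i := s)
    (r := Finsupp.linearCombination R id) fun v => LinearMap.congr_fun hs v

theorem IsFlatModule.pi (h : IsFlatModule R V) (m : ℕ) : IsFlatModule R (Fin m → V) := by
  -- `ULift` moves the index set into the universe `u` required by `IsFlatModule.finsupp`.
  let e := (Finsupp.linearEquivFunOnFinite R V (ULift.{u} (Fin m))).symm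
  let e' := LinearEquiv.funCongrLeft R V (Equiv.ulift.{u} (α := Fin m))
  exact (h.finsupp (ULift.{u} (Fin m))).of_retract (i := (e'.trans e).toLinearMap)
    (r := (e'.trans e).symm.toLinearMap) fun v => (e'.trans e).symm_apply_apply v

theorem isFlatModule_of_subsingleton [Subsingleton V] : IsFlatModule R V :=
  (isFlatModule_self (R := R)).of_retract (i := 0) (r := 0) fun _ => Subsingleton.elim _ _

end Flat

/-! ### Flat dimension and its duality with injective dimension. -/

section FlatDimension

variable {R : Type u} [Ring R]

/-- Dimension shift: discarding `F 0` leaves a resolution of the kernel of the augmentation.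
`FlatDimensionLE.of_ker` reverses this. -/
theorem FlatDimensionLE.ker {m : ℕ} {V : Type u} [AddCommGroup V] [Module R V]
    {F : ℕ → ModuleCat.{u} R} {d : ∀ i, F (i + 1) →ₗ[R] F i} {ε : F 0 →ₗ[R] V}
    (hF : ∀ i, IsFlatModule R (F i)) (h0 : Function.Exact (d 0) ε)
    (hd : ∀ i, Function.Exact (d (i + 1)) (d i)) (hm : ∀ i, m + 1 < i → Subsingleton (F i)) :
    FlatDimensionLE R m (LinearMap.ker ε) := by
  refine ⟨fun i => F (i + 1), fun i => d (i + 1),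
    (d 0).codRestrict _ fun x => h0.apply_apply_eq_zero x, fun i => hF _, fun x => ?_, fun x => ?_,
    fun i => hd _, fun i hi => hm _ (by omega)⟩
  · obtain ⟨y, hy⟩ := (h0 x.1).1 x.2
    exact ⟨y, Subtype.ext hy⟩
  · rw [← hd 0 x, ← Subtype.coe_inj]
    rfl

theorem FlatDimensionLE.of_ker {m : ℕ} {P V : Type u} [AddCommGroup V] [Module R V]
    [AddCommGroup P] [Module R P] (hP : IsFlatModule R P) {ε : P →ₗ[R] V}
    (hε : Function.Surjective ε) (h : FlatDimensionLE R m (LinearMap.ker ε)) :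
    FlatDimensionLE R (m + 1) V := by
  obtain ⟨F, d, η, hF, hη, h0, hd, hm⟩ := h
  let F' : ℕ → ModuleCat.{u} R := fun i => Nat.casesOn i (ModuleCat.of R P) F
  let d' : ∀ i, F' (i + 1) ⟶ F' i := fun i =>
    match i with
    | 0 => ModuleCat.ofHom ((LinearMap.ker ε).subtype.comp η)
    | i + 1 => ModuleCat.ofHom (d i)
  refine ⟨F', fun i => (d' i).hom, ε, ?_, hε, fun x => ?_, ?_, ?_⟩
  · rintro (_ | i)
    exacts [hP, hF i]
  · constructor
    · intro hx
      obtain ⟨y, hy⟩ := hη ⟨x, hx⟩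
      exact ⟨y, congrArg Subtype.val hy⟩
    · rintro ⟨y, rfl⟩
      exact (η y).2
  · rintro (_ | i)
    · exact fun x => (ZeroMemClass.coe_eq_zero (x := η x)).trans (h0 x)
    · exact hd i
  · rintro (_ | i) hi
    exacts [absurd hi (by omega), hm i (by omega)]

theorem IsFlatModule.flatDimensionLE {V : Type u} [AddCommGroup V] [Module R V]
    (h : IsFlatModule R V) : FlatDimensionLE R 0 V := by
  let F : ℕ → ModuleCat.{u} R := fun i => Nat.casesOn i (ModuleCat.of R V) fun _ =>
    ModuleCat.of R PUnit
  have hs (i : ℕ) : Subsingleton (F (i + 1)) := inferInstanceAs (Subsingleton PUnit)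
  refine ⟨F, fun i => 0, (LinearMap.id : V →ₗ[R] V), ?_, Function.surjective_id, fun x => ?_, fun i x => ?_, ?_⟩
  · rintro (_ | i)
    exacts [h, isFlatModule_of_subsingleton]
  · exact ⟨fun hx => ⟨0, hx.symm⟩, fun ⟨_, hy⟩ => hy.symm⟩
  · exact ⟨fun _ => ⟨0, Subsingleton.elim _ _⟩, fun _ => rfl⟩
  · rintro (_ | i) hi
    exacts [absurd hi (by omega), hs i]

/-- The flat dimension of a module is the injective dimension of its character module. -/
theorem flatDimensionLE_iff (m : ℕ) (V : Type u) [AddCommGroup V] [Module R V] :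
    FlatDimensionLE R m V ↔
      HasInjectiveDimensionLE (ModuleCat.of Rᵐᵒᵖ (CharacterDual V)) m := by
  induction m generalizing V with
  | zero =>
    rw [HasInjectiveDimensionLE, zero_add, ← injective_iff_hasInjectiveDimensionLT_one,
      ← Module.injective_iff_injective_object, ← isFlatModule_iff_injective_characterDual]
    refine ⟨fun ⟨F, d, ε, hF, hε, h0, _, hm⟩ => ?_, fun h => h.flatDimensionLE⟩
    -- Here `F 1 = 0`, so `ε` is an isomorphism from the flat module `F 0`.
    have := hm 1 one_pos
    have hinj : Function.Injective ε := (injective_iff_map_eq_zero ε).2 fun x hx => by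
      obtain ⟨y, rfl⟩ := (h0 x).1 hx
      rw [Subsingleton.elim y 0, map_zero]
    let e := LinearEquiv.ofBijective ε ⟨hinj, hε⟩
    exact (hF 0).of_retract (i := e.symm.toLinearMap) (r := e.toLinearMap) e.apply_symm_apply
  | succ m ih =>
    -- The dual of `0 → ker ε → P → V → 0` has the injective middle term `P⋆`, so the injective
    -- dimension drops by one from `V⋆` to `(ker ε)⋆`. Below, `P` is `F 0` in one direction and the
    -- free module on the set `V` in the other.
    have key {P : Type u} [AddCommGroup P] [Module R P] (hP : IsFlatModule R P) {ε : P →ₗ[R] V}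
        (hε : Function.Surjective ε) : FlatDimensionLE R m (LinearMap.ker ε) ↔
          HasInjectiveDimensionLE (ModuleCat.of Rᵐᵒᵖ (CharacterDual V)) (m + 1) := by
      rw [ih]
      refine (CharacterDual.shortExact (LinearMap.ker ε).subtype_injective
        (LinearMap.exact_subtype_ker_map ε) hε).hasInjectiveDimensionLT_X₃_iff m ?_
      exact (Module.injective_iff_injective_object _ _).1
        (isFlatModule_iff_injective_characterDual.1 hP)
    refine ⟨fun ⟨F, d, ε, hF, hε, h0, hd, hm⟩ => ?_, fun h => ?_⟩
    · exact (key (hF 0) hε).1 (.ker hF h0 hd hm)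
    · have hs : Function.Surjective (Finsupp.linearCombination R (id : V → V)) :=
        Finsupp.linearCombination_id_surjective R V
      exact .of_ker (isFlatModule_self.finsupp V) hs ((key (isFlatModule_self.finsupp V) hs).2 h)

/-- On the dual side this is the closure of bounded injective dimension under retracts, which avoids
splitting flat resolutions. -/
theorem FlatDimensionLE.of_retract {m : ℕ} {V W : Type u} [AddCommGroup V] [Module R V]
    [AddCommGroup W] [Module R W] (h : FlatDimensionLE R m W) {i : V →ₗ[R] W} {r : W →ₗ[R] V}
    (hri : ∀ v, r (i v) = v) : FlatDimensionLE R m V := by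
  rw [flatDimensionLE_iff] at *
  exact (CharacterDual.retract hri).hasInjectiveDimensionLT _

theorem Function.Exact.compLeft {A B C : Type u} [AddCommGroup A] [AddCommGroup B]
    [AddCommGroup C] [Module R A] [Module R B] [Module R C] {f : A →ₗ[R] B} {g : B →ₗ[R] C}
    (h : Function.Exact f g) (ι : Type*) :
    Function.Exact (LinearMap.compLeft f ι) (LinearMap.compLeft g ι) := fun x => by
  constructor
  · intro hx
    choose y hy using fun i => (h (x i)).1 (congrFun hx i)
    exact ⟨y, funext hy⟩
  · rintro ⟨y, rfl⟩
    exact funext fun i => h.apply_apply_eq_zero (y i)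

theorem FlatDimensionLE.pi {k : ℕ} {V : Type u} [AddCommGroup V] [Module R V]
    (h : FlatDimensionLE R k V) (m : ℕ) : FlatDimensionLE R k (Fin m → V) := by
  obtain ⟨F, d, ε, hF, hε, h0, hd, hk⟩ := h
  refine ⟨fun i => ModuleCat.of R (Fin m → F i), fun i => LinearMap.compLeft (d i) (Fin m),
    LinearMap.compLeft ε (Fin m), fun i => (hF i).pi m, hε.comp_left, h0.compLeft _,
    fun i => (hd i).compLeft _, fun i hi => ?_⟩
  have := hk i hi
  exact inferInstanceAs (Subsingleton (Fin m → F i))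

end FlatDimension

/-! ### Associativity of the tensor product. -/

namespace BalancedTensor

section Assoc

variable {R S A N V : Type u} [Ring R] [Ring S] [AddCommGroup A] [AddCommGroup N]
  [AddCommGroup V] [Module Rᵐᵒᵖ A] [Module R N] [Module Sᵐᵒᵖ N] [SMulCommClass R Sᵐᵒᵖ N]
  [Module S V]

theorem tmul_zero (a : A) : tmul R a (0 : N) = 0 :=
  (AddMonoidHom.mk' (fun n : N => tmul R a n) (tmul_add R a)).map_zero

/-- The map `n ↦ a ⊗ n` of right modules. -/
def tmulLeft (a : A) : N →ₗ[Sᵐᵒᵖ] BalancedTensor R A N where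
  toFun n := tmul R a n
  map_add' := tmul_add R a
  map_smul' _ _ := rfl

@[simp]
theorem tmulLeft_apply (a : A) (n : N) : tmulLeft (S := S) a n = tmul R a n := rfl

/-- The map `n ↦ n ⊗ v` of left modules. -/
def tmulRight (v : V) : N →ₗ[R] BalancedTensor S N V where
  toFun n := tmul S n v
  map_add' n n' := add_tmul S n n' v
  map_smul' _ _ := rfl

@[simp]
theorem tmulRight_apply (v : V) (n : N) : tmulRight (R := R) v n = tmul S n v := rfl

/-- The associator `A ⊗ (N ⊗ V) → (A ⊗ N) ⊗ V`. -/
def assocInv : BalancedTensor R A (BalancedTensor S N V) →+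
    BalancedTensor S (BalancedTensor R A N) V :=
  lift R
    (AddMonoidHom.mk' (fun a => map S (tmulLeft a) LinearMap.id) fun a a' =>
      addHom_ext S fun n v => by simp [add_tmul])
    fun a r x => by
      induction x using BalancedTensor.induction_on with
      | zero => simp
      | tmul n v => simp [smul_tmul, op_smul_tmul]
      | add x y hx hy => simp only [smul_add, map_add, hx, hy]

/-- The associator `(A ⊗ N) ⊗ V → A ⊗ (N ⊗ V)`. -/
def assocHom : BalancedTensor S (BalancedTensor R A N) V →+
    BalancedTensor R A (BalancedTensor S N V) :=
  lift S
    (AddMonoidHom.flip (AddMonoidHom.mk'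
      (fun v => map R (LinearMap.id : A →ₗ[Rᵐᵒᵖ] A) (tmulRight (R := R) (N := N) v))
      fun v v' => addHom_ext R fun a n => by simp [tmul_add]))
    fun x s v => by
      induction x using BalancedTensor.induction_on with
      | zero => simp
      | tmul a n => simp [op_smul_tmul', op_smul_tmul]
      | add x y hx hy => simp only [smul_add, map_add, AddMonoidHom.add_apply, hx, hy]

/-- This one-sided identity is what makes `assocInv` injective, which is all that
`IsFlatModule.tensor` needs. -/
theorem assocHom_assocInv (x : BalancedTensor R A (BalancedTensor S N V)) :
    assocHom (assocInv x) = x := by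
  induction x using BalancedTensor.induction_on with
  | zero => simp
  | tmul a y =>
    induction y using BalancedTensor.induction_on with
    | zero => simp [tmul_zero]
    | tmul n v => rfl
    | add y z hy hz => rw [tmul_add, map_add, map_add, hy, hz]
  | add x y hx hy => rw [map_add, map_add, hx, hy]

end Assoc

end BalancedTensor

open BalancedTensor in
/-- Tensoring with a bimodule that is flat on the left preserves flatness. -/
theorem IsFlatModule.tensor {R S N V : Type u} [Ring R] [Ring S] [AddCommGroup N]
    [AddCommGroup V] [Module R N] [Module Sᵐᵒᵖ N] [SMulCommClass R Sᵐᵒᵖ N] [Module S V]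
    (hN : IsFlatModule R N) (hV : IsFlatModule S V) :
    IsFlatModule R (BalancedTensor S N V) := by
  intro A B _ _ _ _ f hf
  let fN : BalancedTensor R A N →ₗ[Sᵐᵒᵖ] BalancedTensor R B N :=
    { map R f (LinearMap.id : N →ₗ[R] N) with
      map_smul' := fun s x => by
        change map R _ _ (s • x) = s • map R _ _ x
        induction x using BalancedTensor.induction_on with
        | zero => simp
        | tmul a n => rfl
        | add x y hx hy => simp only [smul_add, map_add, hx, hy] }
  -- Associativity turns `f ⊗ (N ⊗ V)` into `(f ⊗ N) ⊗ V`, which is injective by flatness of `N` and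
  -- then of `V`.
  have hnat (x : BalancedTensor R A (BalancedTensor S N V)) :
      assocInv (map R f (LinearMap.id : _ →ₗ[R] BalancedTensor S N V) x) =
        map S fN (LinearMap.id : V →ₗ[S] V) (assocInv x) := by
    induction x using BalancedTensor.induction_on with
    | zero => simp
    | tmul a y =>
      induction y using BalancedTensor.induction_on with
      | zero => simp [tmul_zero]
      | tmul n v => rfl
      | add y z hy hz => simp only [tmul_add, map_add, hy, hz]
    | add x y hx hy => simp only [map_add, hx, hy]
  intro x y hxy
  have h := congrArg assocInv hxy
  rw [hnat, hnat] at h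
  have h' := congrArg assocHom (hV _ _ fN (hN A B f hf) h)
  rwa [assocHom_assocInv, assocHom_assocInv] at h'

/-! ### Exactness of tensoring with a bimodule. -/

section Functor

variable {R S N : Type u} [Ring R] [Ring S] [AddCommGroup N] [Module S N] [Module Rᵐᵒᵖ N]
  [SMulCommClass S Rᵐᵒᵖ N]

instance : (BalancedTensor.functor R S N).Additive where
  map_add {V W f g} := by
    ext x
    change BalancedTensor.map R LinearMap.id (f + g).hom x =
      BalancedTensor.map R LinearMap.id f.hom x + BalancedTensor.map R LinearMap.id g.hom x
    induction x using BalancedTensor.induction_on with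
    | zero => simp
    | tmul n v => simp [BalancedTensor.tmul_add]
    | add x y hx hy => simp only [map_add, hx, hy]; abel

variable [Limits.PreservesFiniteLimits (BalancedTensor.functor R S N)]
  [Limits.PreservesFiniteColimits (BalancedTensor.functor R S N)]

theorem BalancedTensor.functor_map_exact {U V W : Type u} [AddCommGroup U] [AddCommGroup V]
    [AddCommGroup W] [Module R U] [Module R V] [Module R W] {f : U →ₗ[R] V} {g : V →ₗ[R] W}
    (h : Function.Exact f g) :
    Function.Exact ((functor R S N).map (ModuleCat.ofHom f)).hom
      ((functor R S N).map (ModuleCat.ofHom g)).hom :=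
  (ShortComplex.ShortExact.moduleCat_exact_iff_function_exact _).1
    ((ModuleCat.shortComplex_exact (ModuleCat.shortComplexOfCompEqZero f g
      h.linearMap_comp_eq_zero) h).map (functor R S N))

theorem BalancedTensor.functor_map_injective {V W : Type u} [AddCommGroup V]
    [AddCommGroup W] [Module R V] [Module R W] {f : V →ₗ[R] W} (h : Function.Injective f) :
    Function.Injective ((functor R S N).map (ModuleCat.ofHom f)).hom := by
  have := (ModuleCat.mono_iff_injective (ModuleCat.ofHom f)).2 h
  exact (ModuleCat.mono_iff_injective _).1 inferInstance

theorem BalancedTensor.functor_map_surjective {V W : Type u} [AddCommGroup V]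
    [AddCommGroup W] [Module R V] [Module R W] {f : V →ₗ[R] W} (h : Function.Surjective f) :
    Function.Surjective ((functor R S N).map (ModuleCat.ofHom f)).hom := by
  have := (ModuleCat.epi_iff_surjective (ModuleCat.ofHom f)).2 h
  exact (ModuleCat.epi_iff_surjective _).1 inferInstance

/-- An exact `N ⊗ -` carries a flat resolution of `V` to a resolution, whose terms are flat by
`IsFlatModule.tensor`. -/
theorem FlatDimensionLE.tensor (hN : IsFlatModule S N) {m : ℕ} {V : Type u}
    [AddCommGroup V] [Module R V] (h : FlatDimensionLE R m V) :
    FlatDimensionLE S m ((BalancedTensor.functor R S N).obj (ModuleCat.of R V)) := by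
  obtain ⟨F, d, ε, hF, hε, h0, hd, hm⟩ := h
  refine ⟨fun i => (BalancedTensor.functor R S N).obj (F i),
    fun i => ((BalancedTensor.functor R S N).map (ModuleCat.ofHom (d i))).hom,
    ((BalancedTensor.functor R S N).map (ModuleCat.ofHom ε)).hom, fun i => hN.tensor (hF i),
    BalancedTensor.functor_map_surjective hε, BalancedTensor.functor_map_exact h0,
    fun i => BalancedTensor.functor_map_exact (hd i), fun i hi => ?_⟩
  have := hm i hi
  exact ModuleCat.subsingleton_of_isZero
    ((BalancedTensor.functor R S N).map_isZero (ModuleCat.isZero_of_subsingleton (F i)))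

end Functor

/-! ### Injective hulls. -/

section InjectiveHull

variable {R : Type u} [Ring R]

/-- Every submodule has a maximal disjoint submodule. -/
theorem Submodule.exists_maximal_disjoint {E : Type u} [AddCommGroup E] [Module R E]
    (K : Submodule R E) : ∃ C : Submodule R E, Maximal (Disjoint K) C := by
  obtain ⟨C, -, hC⟩ := zorn_le_nonempty₀ {C : Submodule R E | Disjoint K C}
    (fun c hc hchain _ _ => ⟨sSup c, hchain.directedOn.disjoint_sSup_right.2 fun _ h => hc h,
      fun _ h => le_sSup h⟩) ⊥ disjoint_bot_right
  exact ⟨C, hC⟩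

/-- Every module embeds as an essential submodule in an injective module. -/
theorem exists_injective_hull (V : ModuleCat.{u} R) :
    ∃ (E : ModuleCat.{u} R) (f : V →ₗ[R] E),
      Injective E ∧ Function.Injective f ∧ (LinearMap.range f).IsEssentialIn := by
  obtain ⟨E, hE, j, hj⟩ := (EnoughInjectives.presentation V).some
  have hj' := (ModuleCat.mono_iff_injective j).1 hj
  let A := LinearMap.range j.hom
  -- The hull is a maximal essential extension `K` of `A` inside the injective module `E`. In a
  -- union of a chain, essentiality is tested on cyclic submodules, each of which lies in one
  -- member.
  have hzorn : ∃ K : Submodule R E,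
      Maximal (fun K => A ≤ K ∧ ∀ S ≤ K, S ⊓ A = ⊥ → S = ⊥) K := by
    refine (zorn_le_nonempty₀ {K | A ≤ K ∧ ∀ S ≤ K, S ⊓ A = ⊥ → S = ⊥} ?_ A
      ⟨le_rfl, fun S hS hSA => by rwa [inf_eq_left.2 hS] at hSA⟩).imp fun K hK => hK.2
    refine fun c hc hchain y hy => ⟨sSup c, ⟨(hc hy).1.trans (le_sSup hy), fun S hS hSA => ?_⟩,
      fun _ h => le_sSup h⟩
    refine (Submodule.eq_bot_iff _).2 fun x hx => ?_
    obtain ⟨K, hK, hxK⟩ := (Submodule.mem_sSup_of_directed ⟨y, hy⟩ hchain.directedOn).1 (hS hx)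
    rw [← Submodule.span_singleton_eq_bot (R := R)]
    refine (hc hK).2 _ ((Submodule.span_singleton_le_iff_mem _ _).2 hxK) (eq_bot_iff.2 ?_)
    rw [← hSA]
    exact inf_le_inf_right _ ((Submodule.span_singleton_le_iff_mem _ _).2 hx)
  obtain ⟨K, ⟨hAK, hK⟩, hmax⟩ := hzorn
  -- To split `K` off `E`, embed it in `E ⧸ C` and extend the inclusion `K → E` to `g` on `E ⧸ C`.
  -- Once the range of `g` is `K`, the composite `E → E ⧸ C → K` is a retraction.
  obtain ⟨C, hC, hCmax⟩ := K.exists_maximal_disjoint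
  have hinj : Function.Injective (C.mkQ.comp K.subtype) := by
    refine (injective_iff_map_eq_zero _).2 fun x hx => ?_
    exact Subtype.ext (Submodule.disjoint_def.1 hC x x.2
      ((Submodule.Quotient.mk_eq_zero C).1 hx))
  obtain ⟨g, hg⟩ := ((Module.injective_iff_injective_object R E).2 hE).out
    (C.mkQ.comp K.subtype) hinj K.subtype
  have hKg : K ≤ LinearMap.range g := fun x hx => ⟨_, hg ⟨x, hx⟩⟩
  have hgK : LinearMap.range g ≤ K := by
    -- By maximality of `K` it suffices that the range of `g` is essential over `A`.
    refine hmax ⟨hAK.trans hKg, fun S hS hSA => ?_⟩ hKg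
    have hSK : S ⊓ K = ⊥ := hK _ inf_le_right (by
      rw [eq_bot_iff, ← hSA]
      exact inf_le_inf_right _ inf_le_left)
    -- The preimage of `S` in `E` contains `C` and meets `K` trivially, as `g` fixes `K`; maximality
    -- of `C` forces it into `C`, so `S = 0`.
    have hle : (S.comap g).comap C.mkQ ≤ C := by
      refine hCmax ?_ fun x hx => ?_
      · refine Submodule.disjoint_def.2 fun x hxK hx => ?_
        have hxS : x ∈ S := by
          have : g (C.mkQ x) = x := hg ⟨x, hxK⟩
          rw [← this]
          exact hx
        exact (Submodule.mem_bot R).1 (hSK ▸ ⟨hxS, hxK⟩)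
      · rw [Submodule.mem_comap, Submodule.mkQ_apply, (Submodule.Quotient.mk_eq_zero C).2 hx]
        exact zero_mem _
    refine (Submodule.eq_bot_iff _).2 fun x hx => ?_
    obtain ⟨y, rfl⟩ := hS hx
    obtain ⟨y, rfl⟩ := C.mkQ_surjective y
    rw [Submodule.mkQ_apply, (Submodule.Quotient.mk_eq_zero C).2 (hle hx), map_zero]
  let r : E →ₗ[R] K := (g.codRestrict K fun x => hgK ⟨x, rfl⟩).comp C.mkQ
  refine ⟨ModuleCat.of R K, j.hom.codRestrict K fun x => hAK ⟨x, rfl⟩, ?_, ?_, ?_⟩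
  · have : Retract (ModuleCat.of R K) E :=
      { i := ModuleCat.ofHom K.subtype
        r := ModuleCat.ofHom r
        retract := by
          ext x
          exact hg x }
    exact this.injective
  · exact fun x y hxy => hj' (congrArg Subtype.val hxy)
  · intro S hS
    have h := hK (S.map K.subtype) (Submodule.map_subtype_le K S) (eq_bot_iff.2 ?_)
    · exact Submodule.map_injective_of_injective K.subtype_injective (h.trans (Submodule.map_bot _).symm)
    · rintro _ ⟨⟨x, hx, rfl⟩, v, hv⟩
      have : x ∈ S ⊓ LinearMap.range (j.hom.codRestrict K fun x => hAK ⟨x, rfl⟩) :=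
        ⟨hx, v, Subtype.ext hv⟩
      rw [hS, Submodule.mem_bot] at this
      rw [this, map_zero]
      exact zero_mem _

end InjectiveHull

/-! ### Injective coresolutions with bounded flat dimension. -/

section Coresolution

variable {R : Type u} [Ring R]

/-- The module `V` has the first `n` terms of an injective coresolution in which the `i`-th term has
flat dimension at most `i + k`. -/
def HasFlatInjectiveCoresolution : ℕ → ℕ → ModuleCat.{u} R → Prop
  | 0, _, _ => True
  | n + 1, k, V => ∃ (E C : ModuleCat.{u} R) (f : V →ₗ[R] E) (g : E →ₗ[R] C),
      Injective E ∧ FlatDimensionLE R k E ∧ Function.Injective f ∧ Function.Exact f g ∧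
        Function.Surjective g ∧ HasFlatInjectiveCoresolution n (k + 1) C

theorem HasFlatInjectiveCoresolution.pi {n k : ℕ} {V : ModuleCat.{u} R}
    (h : HasFlatInjectiveCoresolution n k V) (m : ℕ) :
    HasFlatInjectiveCoresolution n k (ModuleCat.of R (Fin m → V)) := by
  induction n generalizing k V with
  | zero => trivial
  | succ n ih =>
    obtain ⟨E, C, f, g, hE, hfd, hf, hfg, hg, h⟩ := h
    refine ⟨ModuleCat.of R (Fin m → E), ModuleCat.of R (Fin m → C), f.compLeft (Fin m),
      g.compLeft (Fin m), ?_, hfd.pi m, hf.comp_left, hfg.compLeft _, hg.comp_left, ih h⟩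
    have := (Module.injective_iff_injective_object R E).2 hE
    exact (Module.injective_iff_injective_object R (Fin m → E)).1 inferInstance

theorem HasFlatInjectiveCoresolution.tensor {S N : Type u} [Ring S] [AddCommGroup N] [Module S N]
    [Module Rᵐᵒᵖ N] [SMulCommClass S Rᵐᵒᵖ N] (hN : IsFlatModule S N)
    [Limits.PreservesFiniteLimits (BalancedTensor.functor R S N)]
    [Limits.PreservesFiniteColimits (BalancedTensor.functor R S N)]
    (hinj : ∀ E : ModuleCat.{u} R, Injective E → Injective ((BalancedTensor.functor R S N).obj E))
    {n k : ℕ} {V : ModuleCat.{u} R} (h : HasFlatInjectiveCoresolution n k V) :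
    HasFlatInjectiveCoresolution n k ((BalancedTensor.functor R S N).obj V) := by
  induction n generalizing k V with
  | zero => trivial
  | succ n ih =>
    obtain ⟨E, C, f, g, hE, hfd, hf, hfg, hg, h⟩ := h
    exact ⟨(BalancedTensor.functor R S N).obj E, (BalancedTensor.functor R S N).obj C,
      ((BalancedTensor.functor R S N).map (ModuleCat.ofHom f)).hom,
      ((BalancedTensor.functor R S N).map (ModuleCat.ofHom g)).hom, hinj E hE, hfd.tensor hN,
      BalancedTensor.functor_map_injective hf, BalancedTensor.functor_map_exact hfg,
      BalancedTensor.functor_map_surjective hg, ih h⟩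

/-- The long exact sequence is cut at the image of `d 0`, which serves as the cokernel of `f`. Each
cut lowers the index by one and raises `k` by one, so the bound `i + k` is unchanged. -/
theorem HasFlatInjectiveCoresolution.of_exact {n k : ℕ} {V : ModuleCat.{u} R}
    {X : ℕ → ModuleCat.{u} R} {f : V →ₗ[R] X 0} {d : ∀ i, X i →ₗ[R] X (i + 1)}
    (hX : ∀ i, Injective (X i)) (hfd : ∀ i < n, FlatDimensionLE R (i + k) (X i))
    (hf : Function.Injective f) (h0 : Function.Exact f (d 0))
    (hd : ∀ i, Function.Exact (d i) (d (i + 1))) : HasFlatInjectiveCoresolution n k V := by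
  induction n generalizing k V X with
  | zero => trivial
  | succ n ih =>
    refine ⟨X 0, ModuleCat.of R (LinearMap.range (d 0)), f, (d 0).rangeRestrict, hX 0,
      by simpa using hfd 0 (by omega), hf, fun x => ?_, (d 0).surjective_rangeRestrict,
      ih (X := fun i => X (i + 1)) (d := fun i => d (i + 1)) (fun i => hX _) (fun i hi => ?_)
        (LinearMap.range (d 0)).subtype_injective (fun x => ?_) fun i => hd _⟩
    · rw [← h0 x, ← Subtype.coe_inj]
      rfl
    · have := hfd (i + 1) (by omega)
      rwa [show i + 1 + k = i + (k + 1) by omega] at this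
    · rw [hd 0 x]
      exact ⟨fun ⟨y, hy⟩ => ⟨⟨x, y, hy⟩, rfl⟩, fun ⟨y, hy⟩ => hy ▸ y.2⟩

/-- A retraction of modules extends to a retraction from an injective module containing the larger
one to an injective hull of the smaller one, and descends to the cokernels. -/
theorem exists_retract_of_essential {V W E J C D : Type u} [AddCommGroup V] [AddCommGroup W]
    [AddCommGroup E] [AddCommGroup J] [AddCommGroup C] [AddCommGroup D] [Module R V] [Module R W]
    [Module R E] [Module R J] [Module R C] [Module R D] {f : V →ₗ[R] E} {g : E →ₗ[R] C}
    {f' : W →ₗ[R] J} {g' : J →ₗ[R] D} (hE : Module.Injective R E) (hJ : Module.Injective R J)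
    (hf : Function.Injective f) (hfg : Function.Exact f g) (hg : Function.Surjective g)
    (hf' : Function.Injective f') (hfg' : Function.Exact f' g') (hg' : Function.Surjective g')
    (hess : (LinearMap.range f').IsEssentialIn) {s : W →ₗ[R] V} {r : V →ₗ[R] W}
    (hrs : ∀ w, r (s w) = w) :
    (∃ (i : J →ₗ[R] E) (p : E →ₗ[R] J), ∀ x, p (i x) = x) ∧
      ∃ (i : D →ₗ[R] C) (p : C →ₗ[R] D), ∀ x, p (i x) = x := by
  obtain ⟨i, hi⟩ := hE.out f' hf' (f.comp s)
  obtain ⟨q, hq⟩ := hJ.out f hf (f'.comp r)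
  have hqi (w : W) : q (i (f' w)) = f' w := by
    rw [hi, LinearMap.comp_apply, hq, LinearMap.comp_apply, hrs]
  -- As `q ∘ i` fixes the range of `f'`, its kernel meets that range trivially and vanishes by
  -- essentiality. Injectivity of `J` then gives a left inverse `t` of `q ∘ i`, and `t ∘ q` retracts
  -- `i`.
  have hker : LinearMap.ker (q.comp i) = ⊥ := by
    refine hess _ (eq_bot_iff.2 ?_)
    rintro _ ⟨hx, w, rfl⟩
    exact (hqi w).symm.trans hx
  obtain ⟨t, ht⟩ := hJ.out (q.comp i) (LinearMap.ker_eq_bot.1 hker) LinearMap.id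
  have hpi (x : J) : t.comp q (i x) = x := ht x
  -- `t` fixes the range of `f'` because `q ∘ i` does, so `t ∘ q` still extends `f' ∘ r` and
  -- descends to the cokernels.
  have hp (v : V) : t.comp q (f v) = f' (r v) := by
    rw [LinearMap.comp_apply, hq, LinearMap.comp_apply]
    conv_lhs => rw [← hqi]
    exact ht _
  refine ⟨⟨i, t.comp q, hpi⟩, ?_⟩
  have hgi : LinearMap.ker g' ≤ LinearMap.ker (g.comp i) := fun x hx => by
    obtain ⟨w, rfl⟩ := (hfg' x).1 hx
    rw [LinearMap.mem_ker, LinearMap.comp_apply, hi]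
    exact hfg.apply_apply_eq_zero _
  have hgp : LinearMap.ker g ≤ LinearMap.ker (g'.comp (t.comp q)) := fun x hx => by
    obtain ⟨v, rfl⟩ := (hfg x).1 hx
    rw [LinearMap.mem_ker, LinearMap.comp_apply, hp]
    exact hfg'.apply_apply_eq_zero _
  let i' : D →ₗ[R] C := ((LinearMap.ker g').liftQ _ hgi).comp
    (g'.quotKerEquivOfSurjective hg').symm.toLinearMap
  let p' : C →ₗ[R] D := ((LinearMap.ker g).liftQ _ hgp).comp
    (g.quotKerEquivOfSurjective hg).symm.toLinearMap
  have hi' (x : J) : i' (g' x) = g (i x) := by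
    have : (g'.quotKerEquivOfSurjective hg').symm (g' x) = (LinearMap.ker g').mkQ x :=
      (LinearEquiv.symm_apply_eq _).2 rfl
    simp only [i', LinearMap.comp_apply, LinearEquiv.coe_coe, this, Submodule.mkQ_apply,
      Submodule.liftQ_apply]
  have hp' (x : E) : p' (g x) = g' (t.comp q x) := by
    have : (g.quotKerEquivOfSurjective hg).symm (g x) = (LinearMap.ker g).mkQ x :=
      (LinearEquiv.symm_apply_eq _).2 rfl
    simp only [p', LinearMap.comp_apply, LinearEquiv.coe_coe, this, Submodule.mkQ_apply,
      Submodule.liftQ_apply]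
  refine ⟨i', p', fun y => ?_⟩
  obtain ⟨x, rfl⟩ := hg' y
  rw [hi', hp', hpi]

/-- By `exists_retract_of_essential`, the retraction passes both to the injective terms, which gives
the bound in this degree, and to the cokernels, where the induction continues. -/
theorem HasFlatInjectiveCoresolution.flatDimensionLE {n k : ℕ} {V : ModuleCat.{u} R}
    (h : HasFlatInjectiveCoresolution n k V) {Z J : ℕ → ModuleCat.{u} R}
    {f : ∀ i, Z i →ₗ[R] J i} {g : ∀ i, J i →ₗ[R] Z (i + 1)} (hJ : ∀ i, Injective (J i))
    (hf : ∀ i, Function.Injective (f i)) (hfg : ∀ i, Function.Exact (f i) (g i))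
    (hg : ∀ i, Function.Surjective (g i)) (hess : ∀ i, (LinearMap.range (f i)).IsEssentialIn)
    {s : Z 0 →ₗ[R] V} {r : V →ₗ[R] Z 0} (hrs : ∀ z, r (s z) = z) :
    ∀ i < n, FlatDimensionLE R (i + k) (J i) := by
  induction n generalizing k V Z J with
  | zero => exact fun i hi => absurd hi (by omega)
  | succ n ih =>
    obtain ⟨E, C, a, b, hE, hfd, ha, hab, hb, h⟩ := h
    obtain ⟨⟨i, p, hip⟩, i', p', hip'⟩ := exists_retract_of_essential
      ((Module.injective_iff_injective_object R E).2 hE)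
      ((Module.injective_iff_injective_object R (J 0)).2 (hJ 0)) ha hab hb (hf 0) (hfg 0) (hg 0)
      (hess 0) hrs
    rintro (_ | j) hj
    · rw [zero_add]
      exact hfd.of_retract hip
    · have := ih h (Z := fun i => Z (i + 1)) (J := fun i => J (i + 1)) (f := fun i => f (i + 1))
        (g := fun i => g (i + 1)) (fun i => hJ _) (fun i => hf _) (fun i => hfg _)
        (fun i => hg _) (fun i => hess _) hip' j (by omega)
      rwa [show j + 1 + k = j + (k + 1) by omega]

end Coresolution

/-! ### Minimal injective resolutions. -/

section MinimalResolution

variable {R : Type u} [Ring R]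

theorem CategoryTheory.InjectiveResolution.hasFlatInjectiveCoresolution {V : ModuleCat.{u} R}
    (I : InjectiveResolution V) {n k : ℕ}
    (h : ∀ i < n, FlatDimensionLE R (i + k) (I.cocomplex.X i)) :
    HasFlatInjectiveCoresolution n k V := by
  have hι : (ShortComplex.mk _ _ I.ι_f_zero_comp_complex_d).Exact :=
    ShortComplex.exact_of_f_is_kernel _ I.isLimitKernelFork
  exact .of_exact (f := (I.ι.f 0).hom) (d := fun i => (I.cocomplex.d i (i + 1)).hom) I.injective h
    ((ModuleCat.mono_iff_injective _).1 inferInstance)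
    ((ShortComplex.ShortExact.moduleCat_exact_iff_function_exact _).1 hι)
    fun i => (ShortComplex.ShortExact.moduleCat_exact_iff_function_exact _).1 (I.exact_succ i)

/-- Splicing embeddings into injective hulls yields a minimal injective resolution. -/
theorem exists_isMinimalInjectiveResolution_of_splice {Z J : ℕ → ModuleCat.{u} R}
    {f : ∀ i, Z i →ₗ[R] J i} {g : ∀ i, J i →ₗ[R] Z (i + 1)} (hJ : ∀ i, Injective (J i))
    (hf : ∀ i, Function.Injective (f i)) (hfg : ∀ i, Function.Exact (f i) (g i))
    (hg : ∀ i, Function.Surjective (g i)) (hess : ∀ i, (LinearMap.range (f i)).IsEssentialIn) :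
    ∃ I : InjectiveResolution (Z 0), IsMinimalInjectiveResolution I ∧
      ∀ i, I.cocomplex.X i = J i := by
  let δ (i : ℕ) : J i ⟶ J (i + 1) := ModuleCat.ofHom ((f (i + 1)).comp (g i))
  let K : CochainComplex (ModuleCat.{u} R) ℕ := CochainComplex.of J δ fun i => by
    ext x
    simp [δ, (hfg (i + 1)).apply_apply_eq_zero]
  have hd (i : ℕ) : K.d i (i + 1) = δ i := CochainComplex.of_d J δ i
  have hker (i : ℕ) : LinearMap.ker (δ i).hom = LinearMap.range (f i) := by
    rw [← (LinearMap.exact_iff.1 (hfg i))]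
    exact LinearMap.ker_comp_of_ker_eq_bot _ (LinearMap.ker_eq_bot.2 (hf (i + 1)))
  have hrange (i : ℕ) : LinearMap.range (δ i).hom = LinearMap.range (f (i + 1)) :=
    LinearMap.range_comp_of_range_eq_top _ (LinearMap.range_eq_top.2 (hg i))
  have hKexact (i : ℕ) : K.ExactAt (i + 1) := by
    rw [HomologicalComplex.exactAt_iff' _ i (i + 1) (i + 1 + 1) (by simp) (by simp),
      ShortComplex.ShortExact.moduleCat_exact_iff_function_exact]
    change Function.Exact (K.d i (i + 1)).hom (K.d (i + 1) (i + 1 + 1)).hom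
    rw [hd, hd]
    exact LinearMap.exact_iff.2 ((hker (i + 1)).trans (hrange i).symm)
  have h0 : ModuleCat.ofHom (f 0) ≫ K.d 0 1 = 0 := by
    rw [hd 0]
    ext x
    simp [δ, (hfg 0).apply_apply_eq_zero]
  have h0exact : (ShortComplex.mk _ _ h0).Exact := by
    rw [ShortComplex.ShortExact.moduleCat_exact_iff_function_exact]
    change Function.Exact (f 0) (K.d 0 1).hom
    rw [hd 0]
    exact LinearMap.exact_iff.2 (hker 0)
  have hmono : Mono (ModuleCat.ofHom (f 0)) := (ModuleCat.mono_iff_injective _).2 (hf 0)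
  refine ⟨{
    cocomplex := K
    injective := hJ
    ι := (CochainComplex.fromSingle₀Equiv _ _).symm ⟨ModuleCat.ofHom (f 0), h0⟩
    quasiIso := ⟨fun n => ?_⟩ }, fun i => ?_, fun _ => rfl⟩
  rotate_left
  · change (LinearMap.ker (K.d i (i + 1)).hom).IsEssentialIn
    rw [hd, hker]
    exact hess i
  -- The augmentation is a quasi-isomorphism in degree zero when `0 → Z 0 → J 0 → J 1` is exact, and
  -- in positive degrees when `K` is exact.
  cases n with
  | zero =>
    rw [CochainComplex.quasiIsoAt₀_iff, ShortComplex.quasiIso_iff_of_zeros]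
    · refine (ShortComplex.exact_and_mono_f_iff_of_iso ?_).2 ⟨h0exact, hmono⟩
      exact ShortComplex.isoMk (Iso.refl _) (Iso.refl _) (Iso.refl _)
        (by
          rw [Iso.refl_hom, Iso.refl_hom]
          refine (Category.id_comp _).trans ?_
          refine .trans ?_ (Category.comp_id _).symm
          simp
          rfl)
        ((Category.id_comp _).trans (Category.comp_id _).symm)
    all_goals rfl
  | succ n =>
    rw [quasiIsoAt_iff_exactAt]
    · exact hKexact n
    · exact CochainComplex.exactAt_succ_single_obj _ _

/-- Alternate injective hulls and cokernels: `Z (i + 1)` is the cokernel of the embedding of `Z i`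
in its hull. -/
theorem exists_minimal_splice (V : ModuleCat.{u} R) :
    ∃ (Z J : ℕ → ModuleCat.{u} R) (f : ∀ i : ℕ, Z i →ₗ[R] J i)
      (g : ∀ i : ℕ, J i →ₗ[R] Z (i + 1)),
      Z 0 = V ∧ (∀ i, Injective (J i)) ∧ (∀ i, Function.Injective (f i)) ∧
      (∀ i, Function.Exact (f i) (g i)) ∧ (∀ i, Function.Surjective (g i)) ∧
      ∀ i, (LinearMap.range (f i)).IsEssentialIn := by
  choose E f hE hf hess using exists_injective_hull (R := R)
  let C (W : ModuleCat.{u} R) : ModuleCat.{u} R := ModuleCat.of R (E W ⧸ LinearMap.range (f W))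
  let π (W : ModuleCat.{u} R) : E W →ₗ[R] C W := (LinearMap.range (f W)).mkQ
  have hπ (W : ModuleCat.{u} R) : Function.Exact (f W) (π W) := (f W).exact_map_mkQ_range
  let Z : ℕ → ModuleCat.{u} R := fun i => Nat.rec V (fun _ W => C W) i
  exact ⟨Z, fun i => E (Z i), fun i => f (Z i), fun i => π (Z i), rfl,
    fun i => hE _, fun i => hf _, fun i => hπ (Z i),
    fun i => Submodule.mkQ_surjective _, fun i => hess _⟩

/-- Flat dimensions in an arbitrary injective coresolution of a module bound those in the minimal
injective resolution of the ring, if the ring is a direct summand of the module. -/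
theorem HasFlatInjectiveCoresolution.isGorensteinType {n k : ℕ} {V : ModuleCat.{u} R}
    (h : HasFlatInjectiveCoresolution n k V) {s : R →ₗ[R] V} {r : V →ₗ[R] R}
    (hrs : ∀ x, r (s x) = x) : IsGorensteinType R n k := by
  obtain ⟨Z, J, f, g, hZ, hJ, hf, hfg, hg, hess⟩ := exists_minimal_splice (ModuleCat.of R R)
  -- The resolution resolves `Z 0`, which is equal to the regular module only through `hZ`; the
  -- claim is therefore proved for `Z 0` and then rewritten.
  have key : ∃ I : InjectiveResolution (Z 0), IsMinimalInjectiveResolution I ∧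
      ∀ i < n, FlatDimensionLE R (i + k) (I.cocomplex.X i) := by
    obtain ⟨I, hmin, hI⟩ := exists_isMinimalInjectiveResolution_of_splice hJ hf hfg hg hess
    refine ⟨I, hmin, fun i hi => ?_⟩
    rw [hI]
    let e : Z 0 ≃ₗ[R] R := (eqToIso hZ).toLinearEquiv
    refine h.flatDimensionLE hJ hf hfg hg hess (s := s.comp e.toLinearMap)
      (r := e.symm.toLinearMap.comp r) (fun z => ?_) i hi
    simp [hrs]
  rwa [hZ] at key

end MinimalResolution

/-! ### Transfer along the separable equivalence. -/

section Transfer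

theorem IsGorensteinType.of_adjunctions {Λ Γ M N : Type u} [Ring Λ] [Ring Γ]
    [AddCommGroup M] [Module Λ M] [Module Γᵐᵒᵖ M] [SMulCommClass Λ Γᵐᵒᵖ M]
    [AddCommGroup N] [Module Γ N] [Module Λᵐᵒᵖ N] [SMulCommClass Γ Λᵐᵒᵖ N]
    [Module.Finite Λ M] [Module.Projective Λ M] [Module.Projective Γ N]
    (hsum : HasRegularSummand Γ (BalancedTensor Λ N M))
    (adj : BalancedTensor.functor Γ Λ M ⊣ BalancedTensor.functor Λ Γ N)
    (adj' : BalancedTensor.functor Λ Γ N ⊣ BalancedTensor.functor Γ Λ M) {n k : ℕ}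
    (h : IsGorensteinType Λ n k) : IsGorensteinType Γ n k := by
  obtain ⟨I, -, hI⟩ := h
  -- The first two facts make `N ⊗ -` exact. The third makes `M ⊗ -` preserve monomorphisms, whence
  -- its right adjoint `N ⊗ -` preserves injectives.
  have := adj.rightAdjoint_preservesLimits
  have := adj'.leftAdjoint_preservesColimits
  have := adj'.rightAdjoint_preservesLimits
  -- The surjection `p` from `Λ^m` splits, so `M` is a summand of `Λ^m`.
  obtain ⟨m, p, hp⟩ := Module.Finite.exists_fin' Λ M
  obtain ⟨j, hj⟩ := Module.projective_lifting_property p LinearMap.id hp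
  have hcores := ((I.hasFlatInjectiveCoresolution hI).pi m).tensor
    (isFlatModule_of_projective (R := Γ) (V := N)) fun E hE => adj.map_injective E hE
  obtain ⟨Y, _, _, _, _, e, -⟩ := hsum
  let G := BalancedTensor.functor Λ Γ N
  have hG (x : BalancedTensor Λ N M) :
      (G.map (ModuleCat.ofHom p)).hom ((G.map (ModuleCat.ofHom j)).hom x) = x := by
    have : G.map (ModuleCat.ofHom j) ≫ G.map (ModuleCat.ofHom p) = 𝟙 _ := by
      rw [← G.map_comp, ← ModuleCat.ofHom_comp, hj]
      exact G.map_id (ModuleCat.of Λ M)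
    exact congrArg (fun t => t.hom x) this
  -- The section is `Γ → Γ ⊕ Y ≅ N ⊗ M → N ⊗ Λ^m`, and the retraction runs back along the same
  -- modules.
  exact hcores.isGorensteinType
    (s := (G.map (ModuleCat.ofHom j)).hom.comp (e.symm.toLinearMap.comp (LinearMap.inl Γ Γ Y)))
    (r := (LinearMap.fst Γ Γ Y).comp (e.toLinearMap.comp (G.map (ModuleCat.ofHom p)).hom))
    fun x => by
      refine (congrArg (fun t => (e t).1) (hG _)).trans ?_
      exact congrArg Prod.fst (e.apply_symm_apply (x, 0))

theorem SymmetricallySeparablyEquivalent.isGorensteinType_iff {Λ Γ : Type u} [Ring Λ] [Ring Γ]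
    (h : SymmetricallySeparablyEquivalent Λ Γ) (n k : ℕ) :
    IsGorensteinType Λ n k ↔ IsGorensteinType Γ n k := by
  obtain ⟨M, N, _, _, _, _, _, _, _, _, hMN, ⟨adj⟩, ⟨adj'⟩⟩ := h
  have := hMN.finite_left_M
  have := hMN.projective_left_M
  have := hMN.finite_left_N
  have := hMN.projective_left_N
  exact ⟨.of_adjunctions hMN.summand_right adj adj', .of_adjunctions hMN.summand_left adj' adj⟩

end Transfer

theorem corollary4p6 (Λ Γ : Type u) [Ring Λ] [Ring Γ]
    [IsNoetherianRing Λ] [IsNoetherianRing Λᵐᵒᵖ] [IsNoetherianRing Γ] [IsNoetherianRing Γᵐᵒᵖ]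
    (h : SymmetricallySeparablyEquivalent Λ Γ) :
    (∀ n : ℕ, IsNGorenstein Λ n ↔ IsNGorenstein Γ n) ∧
    (∀ n : ℕ, IsQuasiNGorenstein Λ n ↔ IsQuasiNGorenstein Γ n) ∧
    (AuslanderCondition Λ ↔ AuslanderCondition Γ) :=
  ⟨fun n => h.isGorensteinType_iff n 0, fun n => h.isGorensteinType_iff n 1,
    forall_congr' fun n => h.isGorensteinType_iff n 0⟩
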